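/- For real $\rho\in[-1,1]$ let $(\mathbf g_1,\mathbf g_2)$ be $\rho$-correlated standard Gaussians, i.e. $\mathbf g_1=\rho\,\mathbf g_2+\sqrt{1-\rho^2}\,\mathbf g_3$ with $\mathbf g_2,\mathbf g_3$ independent $N(0,1)$ variables, and for $r>0$ let $\gamma_r=(\mathbb E_{g\sim N(0,1)}|g|^r)^{1/r}$. Write $(\tau)_k=\tau(\tau+1)\cdots(\tau+k-1)$ and ${}_2F_1(w,\alpha;\beta;\lambda)=\sum_{k\ge 0}\frac{(w)_k(\alpha)_k}{(\beta)_k}\frac{\lambda^k}{k!}$. Let $a,b\in(-1,\infty)$ and put $$\tilde f_{a,b}(\rho)=\frac{1}{\gamma_{a+1}^{a+1}\,\gamma_{b+1}^{b+1}}\;\mathbb E\big[\operatorname{sgn}(\mathbf g_1)|\mathbf g_1|^a\,\operatorname{sgn}(\mathbf g_2)|\mathbf g_2|^b\big].$$ 1. For every $\rho\in[-1,1]$, $$\tilde f_{a,b}(\rho)=\rho\cdot{}_2F_1\!\left(\tfrac{1-a}{2},\tfrac{1-b}{2};\tfrac32;\rho^2\right).$$ If $|\rho|<1$ or $a+b>-1$,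 the expectation exists (the integrand is integrable) and the series converges. If $|\rho|=1$ and $a+b\le-1$, the identity holds in the extended sense: $\rho\cdot\operatorname{sgn}(\mathbf g_1)|\mathbf g_1|^a\operatorname{sgn}(\mathbf g_2)|\mathbf g_2|^b$ is almost surely nonnegative with expectation $+\infty$, and the series ${}_2F_1\!\left(\tfrac{1-a}{2},\tfrac{1-b}{2};\tfrac32;1\right)$ diverges to $+\infty$. 2. The function $\tilde f_{a,b}$ is analytic at $0$, and for every integer $k\ge 0$ its $(2k+1)$-th Taylor coefficient at $0$ is $$\frac{\left(\frac{1-a}{2}\right)_k\left(\frac{1-b}{2}\right)_k}{\left(\frac32\right)_k\,k!}.$$ 3. In particular (the case $a=b=0$, Grothendieck's identity), for every $\rho\in[-1,1]$, $\mathbb E[\operatorname{sgn}(\mathbf g_1)\operatorname{sgn}(\mathbf g_2)]=\frac{2}{\pi}\arcsin\rho$. -/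

import Mathlib

open MeasureTheory ProbabilityTheory Filter

noncomputable section

/-- The law of a pair `(g₁, g₂)` of `ρ`-correlated standard Gaussians: `g₂ = x` and
`g₁ = ρ x + √(1 - ρ²) y` with `x, y` independent standard Gaussians (for `-1 ≤ ρ ≤ 1`). -/
def correlatedGaussian (ρ : ℝ) : Measure (ℝ × ℝ) :=
  ((gaussianReal 0 1).prod (gaussianReal 0 1)).map
    (fun z : ℝ × ℝ => (ρ * z.1 + √(1 - ρ ^ 2) * z.2, z.1))

/-- The `r`-th Gaussian norm `γ_r = (E |g|^r)^(1/r)` of a standard Gaussian `g`. -/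
def gaussianNorm (r : ℝ) : ℝ :=
  (∫ x, |x| ^ r ∂(gaussianReal 0 1)) ^ (1 / r)

/-- The function `τ ↦ sgn(τ) |τ|^c`. -/
def signedPow (c τ : ℝ) : ℝ := Real.sign τ * |τ| ^ c

/-- The correlation `E[sgn(g₁) |g₁|^a · sgn(g₂) |g₂|^b]` of `ρ`-correlated standard Gaussians,
divided by `γ_{a+1}^{a+1} γ_{b+1}^{b+1}`. -/
def normalizedCorrelation (a b ρ : ℝ) : ℝ :=
  1 / (gaussianNorm (a + 1) ^ (a + 1) * gaussianNorm (b + 1) ^ (b + 1)) *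
    ∫ z, signedPow a z.1 * signedPow b z.2 ∂(correlatedGaussian ρ)

end

/-! ### The ordinary hypergeometric series -/

section Hypergeometric

open scoped Topology

/-! For `|ρ| < 1` put `u = 1 - ρ²`. The joint density of the pair is a product of two Gaussian
factors of variance `u` times `exp (ρ x y / u)`. Expanding this exponential separates the variables.
Even powers integrate to zero against the odd function `signedPow`, and odd powers give absolute
Gaussian moments, that is, rising factorials of `1 + a/2` and `1 + b/2`. The sum is `ρ u ^ ((1 + a +
b)/2) F(1 + a/2, 1 + b/2; 3/2; ρ²)` up to the normalizing moments, and Euler's transformation turns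
it into the stated series. Euler's transformation is proved for formal power series: both sides
satisfy the hypergeometric equation, whose solution is determined by its constant term.

At `|ρ| = 1` the pair is degenerate and the correlation is `ρ E|g|^(a+b)`, so the identity amounts
to Gauss's value of `F` at `1`. For `a, b > 0` it follows by letting `ρ → 1`, with dominated
convergence on one side and Abel's theorem on the other; a contiguous relation and the moment
recursion then lower `a` and `b` by `2`. If `a + b ≤ -1`, the moment is infinite and the
coefficients dominate a harmonic series.

The Taylor coefficients are read off the series. Grothendieck's identity holds because the series
for `a = b = 0` has the derivative of `arcsin`. -/

theorem ordinaryHypergeometricCoefficient_zero (α β γ : ℝ) :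
    ordinaryHypergeometricCoefficient α β γ 0 = 1 := by
  simp [ordinaryHypergeometricCoefficient]

theorem ordinaryHypergeometricCoefficient_succ (α β : ℝ) {γ : ℝ} (hγ : 0 < γ) (k : ℕ) :
    (k + 1) * (k + γ) * ordinaryHypergeometricCoefficient α β γ (k + 1) =
      (k + α) * (k + β) * ordinaryHypergeometricCoefficient α β γ k := by
  have h1 := (ascPochhammer_pos k γ hγ).ne'
  have h2 : (0 : ℝ) < γ + k := by positivity
  simp only [ordinaryHypergeometricCoefficient, ascPochhammer_succ_eval, Nat.factorial_succ,
    Nat.cast_mul, Nat.cast_add, Nat.cast_one]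
  field_simp
  ring

theorem ordinaryHypergeometricCoefficient_succ' (α β : ℝ) {γ : ℝ} (hγ : 0 < γ) (k : ℕ) :
    ordinaryHypergeometricCoefficient α β γ (k + 1) =
      (α + k) / (1 + k) * ((β + k) / (γ + k)) * ordinaryHypergeometricCoefficient α β γ k := by
  have h2 : (0 : ℝ) < γ + k := by positivity
  have h3 : (0 : ℝ) < 1 + k := by positivity
  have := ordinaryHypergeometricCoefficient_succ α β hγ k
  rw [div_mul_div_comm, div_mul_eq_mul_div, eq_div_iff (by positivity)]
  linear_combination this

theorem ordinaryHypergeometricCoefficient_pos {α β γ : ℝ} (hα : 0 < α) (hβ : 0 < β) (hγ : 0 < γ)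
    (k : ℕ) : 0 < ordinaryHypergeometricCoefficient α β γ k := by
  have h1 := ascPochhammer_pos k α hα
  have h2 := ascPochhammer_pos k β hβ
  have h3 := ascPochhammer_pos k γ hγ
  simp only [ordinaryHypergeometricCoefficient]
  positivity

/-- Ratio test: the quotient of consecutive terms tends to `|z|` in absolute value. -/
theorem summable_norm_ordinaryHypergeometricCoefficient_mul_pow (α β : ℝ) {γ z : ℝ} (hγ : 0 < γ)
    (hz : |z| < 1) :
    Summable fun k : ℕ => ‖ordinaryHypergeometricCoefficient α β γ k * z ^ k‖ := by
  obtain ⟨r, hr, hr1⟩ := exists_between hz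
  have hlim : Tendsto (fun k : ℕ => |(α + k) / (1 + k) * ((β + k) / (γ + k)) * z|) atTop
      (𝓝 |1 * 1 * z|) := by
    refine Tendsto.abs (Tendsto.mul_const _ (Tendsto.mul ?_ ?_)) <;>
    · convert! tendsto_add_mul_div_add_mul_atTop_nhds _ _ (1 : ℝ) one_ne_zero <;> simp
  rw [one_mul, one_mul] at hlim
  refine summable_of_ratio_norm_eventually_le hr1 ?_
  filter_upwards [hlim.eventually (gt_mem_nhds hr)] with k hk
  rw [norm_norm, norm_norm, ordinaryHypergeometricCoefficient_succ' α β hγ]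
  calc _ = |(α + k) / (1 + k) * ((β + k) / (γ + k)) * z| *
        ‖ordinaryHypergeometricCoefficient α β γ k * z ^ k‖ := by
        rw [← Real.norm_eq_abs, ← norm_mul]; congr 1; ring
    _ ≤ _ := by gcongr

theorem ordinaryHypergeometric_real_eq_tsum (α β γ z : ℝ) :
    ordinaryHypergeometric α β γ z =
      ∑' k : ℕ, ordinaryHypergeometricCoefficient α β γ k * z ^ k := by
  rw [ordinaryHypergeometric_eq_tsum]; rfl

/-! ### Formal power series and Euler's transformation -/

/-- The Euler operator `X d/dX` on formal power series. -/
noncomputable def PowerSeries.eulerOp (f : PowerSeries ℝ) : PowerSeries ℝ :=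
  PowerSeries.X * PowerSeries.derivative ℝ f

namespace PowerSeries

theorem coeff_eulerOp (f : PowerSeries ℝ) (n : ℕ) : coeff n (eulerOp f) = n * coeff n f := by
  cases n with
  | zero => simp [eulerOp]
  | succ n => rw [eulerOp, coeff_succ_X_mul, coeff_derivative]; push_cast; ring

theorem eulerOp_mul (f g : PowerSeries ℝ) :
    eulerOp (f * g) = eulerOp f * g + f * eulerOp g := by
  simp only [eulerOp, Derivation.leibniz, smul_eq_mul]; ring

theorem eulerOp_add (f g : PowerSeries ℝ) : eulerOp (f + g) = eulerOp f + eulerOp g := by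
  simp only [eulerOp, map_add]; ring

theorem eulerOp_C (r : ℝ) : eulerOp (C r) = 0 := by
  ext n; rw [coeff_eulerOp, coeff_C]; split_ifs with h <;> simp [h]

theorem eulerOp_X : eulerOp (X : PowerSeries ℝ) = X := by
  ext n; rw [coeff_eulerOp, coeff_X]; split_ifs with h <;> simp [h]

/-- The hypergeometric differential equation in terms of the Euler operator. -/
def IsHypergeometric (α β γ : ℝ) (f : PowerSeries ℝ) : Prop :=
  eulerOp (eulerOp f) + C (γ - 1) * eulerOp f =
    X * (eulerOp (eulerOp f) + C (α + β) * eulerOp f + C (α * β) * f)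

/-- `eulerOp` multiplies the `n`-th coefficient by `n`, so comparing coefficients of `X ^ (n + 1)`
gives the recursion; both constant terms vanish. -/
theorem isHypergeometric_iff (α β γ : ℝ) (f : PowerSeries ℝ) :
    IsHypergeometric α β γ f ↔
      ∀ n : ℕ, (n + 1) * (n + γ) * coeff (n + 1) f = (n + α) * (n + β) * coeff n f := by
  rw [IsHypergeometric, PowerSeries.ext_iff]
  refine ⟨fun h n => ?_, fun h n => ?_⟩
  · have := h (n + 1)
    simp only [LinearMap.map_add, coeff_succ_X_mul, coeff_C_mul, coeff_eulerOp] at this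
    push_cast at this
    linear_combination this
  · cases n with
    | zero => rw [coeff_zero_X_mul, LinearMap.map_add, coeff_C_mul, coeff_eulerOp, coeff_eulerOp]; simp
    | succ n =>
      have := h n
      simp only [LinearMap.map_add, coeff_succ_X_mul, coeff_C_mul, coeff_eulerOp]
      push_cast
      linear_combination this

/-- The formal hypergeometric series. -/
noncomputable def hypergeometric (α β γ : ℝ) : PowerSeries ℝ :=
  mk (ordinaryHypergeometricCoefficient α β γ)

theorem isHypergeometric_hypergeometric (α β : ℝ) {γ : ℝ} (hγ : 0 < γ) :
    IsHypergeometric α β γ (hypergeometric α β γ) := by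
  rw [isHypergeometric_iff]
  intro n
  simpa [hypergeometric] using ordinaryHypergeometricCoefficient_succ α β hγ n

/-- For `γ > 0` the factor `(n + 1) * (n + γ)` never vanishes, so the recursion propagates equality
from the constant term. -/
theorem IsHypergeometric.eq_hypergeometric {α β γ : ℝ} (hγ : 0 < γ) {f : PowerSeries ℝ}
    (hf : IsHypergeometric α β γ f) (h0 : coeff 0 f = 1) : f = hypergeometric α β γ := by
  rw [isHypergeometric_iff] at hf
  ext n
  induction n with
  | zero => rw [h0, hypergeometric, coeff_mk, ordinaryHypergeometricCoefficient_zero]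
  | succ n ih =>
    have h1 := hf n
    have h2 := (isHypergeometric_iff _ _ _ _).1 (isHypergeometric_hypergeometric α β hγ) n
    rw [ih, ← h2] at h1
    exact mul_left_cancel₀ (by positivity) h1

/-- This series is formally `(1 - X) ^ (-c)`; the identity is its first-order differential equation.
-/
theorem eulerOp_hypergeometric_one_one (c : ℝ) :
    (1 - X) * eulerOp (hypergeometric c 1 1) = C c * X * hypergeometric c 1 1 := by
  ext n
  rw [sub_mul, one_mul, mul_assoc, coeff_C_mul, map_sub, coeff_eulerOp]
  cases n with
  | zero => simp
  | succ n =>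
    have h := ordinaryHypergeometricCoefficient_succ c 1 one_pos n
    rw [coeff_succ_X_mul, coeff_succ_X_mul, coeff_eulerOp]
    simp only [hypergeometric, coeff_mk]
    have h' : ((n : ℝ) + 1) ≠ 0 := by positivity
    apply mul_left_cancel₀ h'
    push_cast
    linear_combination h

/-- **Euler's transformation** of the hypergeometric series, formally. -/
theorem hypergeometric_euler (α β : ℝ) {γ : ℝ} (hγ : 0 < γ) :
    hypergeometric (α + β - γ) 1 1 * hypergeometric (γ - α) (γ - β) γ =
      hypergeometric α β γ := by
  set B := hypergeometric (α + β - γ) 1 1 with hB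
  set G := hypergeometric (γ - α) (γ - β) γ with hG
  have e1 : (1 - X) * eulerOp B = C (α + β - γ) * X * B := eulerOp_hypergeometric_one_one _
  have e3 : IsHypergeometric (γ - α) (γ - β) γ G := isHypergeometric_hypergeometric _ _ hγ
  have e2 : (1 - X) * eulerOp (eulerOp B) - X * eulerOp B =
      C (α + β - γ) * X * B + C (α + β - γ) * X * eulerOp B := by
    have := congrArg eulerOp e1
    have hX : (1 - X : PowerSeries ℝ) = C 1 + C (-1) * X := by simp [sub_eq_add_neg]
    rw [eulerOp_mul, eulerOp_mul, eulerOp_mul, eulerOp_C, eulerOp_X, hX, eulerOp_add, eulerOp_mul,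
      eulerOp_C, eulerOp_C, eulerOp_X] at this
    simp only [map_neg, map_one] at this
    linear_combination this
  refine IsHypergeometric.eq_hypergeometric hγ ?_ ?_
  -- Multiplying by `1 - X` loses nothing in a domain and lets `e1` and `e2` eliminate the
  -- derivatives of `B`, while `e3` eliminates the second derivative of `G`.
  · have hne : (1 - X : PowerSeries ℝ) ≠ 0 := by
      intro h
      simpa using congrArg (coeff 0) h
    rw [IsHypergeometric] at e3 ⊢
    apply mul_left_cancel₀ hne
    rw [eulerOp_mul, eulerOp_add, eulerOp_mul, eulerOp_mul]
    simp only [map_add, map_sub, map_mul, map_one] at e1 e2 e3 ⊢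
    linear_combination (1 - X) * G * e2 + (1 - X) * B * e3 +
      (G * (1 + C α + C β - C γ) * X + 2 * eulerOp G * (1 - X) +
        ((C γ - 1) - X * (C α + C β)) * G) * e1
  · simp [hB, hG, hypergeometric, ordinaryHypergeometricCoefficient_zero]

end PowerSeries

end Hypergeometric

/-! ### Convergent hypergeometric series and their behaviour at `z = 1` -/

section HypergeometricAnalytic

open scoped Topology

theorem ordinaryHypergeometric_one_one (c : ℝ) {z : ℝ} (hz : |z| < 1) :
    ordinaryHypergeometric (-c) 1 1 z = (1 - z) ^ c := by
  have h := (Real.one_add_rpow_hasFPowerSeriesOnBall_zero (a := c)).hasSum (y := -z) (by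
    simpa [Metric.mem_eball, edist_dist, Real.dist_eq] using hz)
  rw [binomialSeries_eq_ordinaryHypergeometricSeries (b := (1 : ℝ))
    (fun k => by have : (0 : ℝ) ≤ k := k.cast_nonneg
                 linarith)] at h
  rw [ordinaryHypergeometric_eq_tsum, sub_eq_add_neg]
  rw [zero_add] at h
  rw [← h.tsum_eq]
  refine tsum_congr fun n => ?_
  rw [← ordinaryHypergeometricSeries_apply_eq]
  rw [FormalMultilinearSeries.compContinuousLinearMap_apply]
  congr 1
  ext i
  simp

/-- **Euler's transformation** of the hypergeometric function. -/
theorem ordinaryHypergeometric_euler (α β : ℝ) {γ z : ℝ} (hγ : 0 < γ) (hz : |z| < 1) :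
    ordinaryHypergeometric α β γ z =
      (1 - z) ^ (γ - α - β) * ordinaryHypergeometric (γ - α) (γ - β) γ z := by
  rw [← ordinaryHypergeometric_one_one _ hz, show -(γ - α - β) = α + β - γ by ring]
  simp only [ordinaryHypergeometric_real_eq_tsum]
  -- The Cauchy product reduces the claim to the formal identity, coefficient by coefficient.
  rw [tsum_mul_tsum_eq_tsum_sum_antidiagonal_of_summable_norm
    (summable_norm_ordinaryHypergeometricCoefficient_mul_pow _ _ one_pos hz)
    (summable_norm_ordinaryHypergeometricCoefficient_mul_pow _ _ hγ hz)]
  refine tsum_congr fun n => ?_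
  have h := congrArg (PowerSeries.coeff n) (PowerSeries.hypergeometric_euler α β hγ)
  simp only [PowerSeries.hypergeometric, PowerSeries.coeff_mul, PowerSeries.coeff_mk] at h
  rw [← h, Finset.sum_mul]
  refine Finset.sum_congr rfl fun p hp => ?_
  rw [← Finset.HasAntidiagonal.mem_antidiagonal.1 hp, pow_add]
  ring

/-- The eventually decreasing sequence `k * f k` has a limit `l ≥ 0`; if `l > 0`, then `f k ≥ l / k`
for large `k`, contradicting summability. -/
theorem tendsto_mul_of_summable_of_antitone {f : ℕ → ℝ} (hf : Summable f) (h0 : ∀ k, 0 ≤ f k)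
    {N : ℕ} (hN : ∀ k, N ≤ k → ((k + 1 : ℕ) : ℝ) * f (k + 1) ≤ k * f k) :
    Tendsto (fun k : ℕ => k * f k) atTop (𝓝 0) := by
  have hanti : Antitone fun k : ℕ => ((k + N : ℕ) : ℝ) * f (k + N) :=
    antitone_nat_of_succ_le fun k => by
      have := hN (k + N) (by lia)
      rwa [show k + 1 + N = k + N + 1 by lia]
  have hbdd : BddBelow (Set.range fun k : ℕ => ((k + N : ℕ) : ℝ) * f (k + N)) :=
    ⟨0, by rintro _ ⟨k, rfl⟩; exact mul_nonneg (Nat.cast_nonneg _) (h0 _)⟩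
  have hlim := tendsto_atTop_ciInf hanti hbdd
  set l := ⨅ k : ℕ, ((k + N : ℕ) : ℝ) * f (k + N) with hl
  have hl0 : 0 ≤ l := le_ciInf fun k => mul_nonneg (Nat.cast_nonneg _) (h0 _)
  rcases hl0.eq_or_lt with hl0 | hl0
  · rw [← hl0] at hlim
    exact (tendsto_add_atTop_iff_nat N).1 hlim
  · exfalso
    refine Real.not_summable_one_div_natCast ?_
    rw [← summable_nat_add_iff (N + 1)]
    refine Summable.of_nonneg_of_le (fun k => by positivity) (fun k => ?_)
      (((summable_nat_add_iff (N + 1)).2 hf).mul_left l⁻¹)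
    have h1 : l ≤ ((k + 1 + N : ℕ) : ℝ) * f (k + 1 + N) := ciInf_le hbdd (k + 1)
    rw [show k + (N + 1) = k + 1 + N by lia, inv_mul_eq_div, div_le_div_iff₀ (by positivity) hl0]
    linarith

/-- Raabe's test. With `δ = γ - α - β`, the difference `k f k - (k + 1) f (k + 1)` is at least `(δ /
2) f k` for large `k`, and it telescopes. -/
theorem ordinaryHypergeometricCoefficient_summable_and_tendsto {α β γ : ℝ} (hγ : 0 < γ)
    (hd : 0 < γ - α - β) :
    (Summable fun k : ℕ => |ordinaryHypergeometricCoefficient α β γ k|) ∧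
    Tendsto (fun k : ℕ => k * |ordinaryHypergeometricCoefficient α β γ k|) atTop (𝓝 0) := by
  set f : ℕ → ℝ := fun k => |ordinaryHypergeometricCoefficient α β γ k| with hf
  have hf0 : ∀ k, 0 ≤ f k := fun k => abs_nonneg _
  -- The first two summands make `k + α` and `k + β` positive; the third absorbs the lower-order
  -- terms in `key`.
  obtain ⟨N, hN⟩ := exists_nat_gt (|α| + |β| + |2 * α * β + (γ - α - β) * γ| / (γ - α - β))
  have key : ∀ k, N ≤ k → (γ - α - β) / 2 * f k ≤ k * f k - ((k + 1 : ℕ) : ℝ) * f (k + 1) := by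
    intro k hk
    have hk' : (N : ℝ) ≤ k := by exact_mod_cast hk
    have hq : 0 ≤ |2 * α * β + (γ - α - β) * γ| / (γ - α - β) := by positivity
    have hα : 0 < k + α := by linarith [neg_abs_le α, abs_nonneg β]
    have hβ : 0 < k + β := by linarith [neg_abs_le β, abs_nonneg α]
    have hkγ : 0 < k + γ := by positivity
    have hbig : 2 * α * β + (γ - α - β) * γ ≤ (γ - α - β) * k := by
      have h1 : |2 * α * β + (γ - α - β) * γ| / (γ - α - β) ≤ k := by
        linarith [abs_nonneg α, abs_nonneg β]
      rw [div_le_iff₀ hd] at h1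
      linarith [le_abs_self (2 * α * β + (γ - α - β) * γ)]
    have hs : (k + 1) * (k + γ) * f (k + 1) = (k + α) * (k + β) * f k := by
      have h := congrArg abs (ordinaryHypergeometricCoefficient_succ α β hγ k)
      rwa [abs_mul (((k : ℝ) + 1) * (k + γ)), abs_mul (((k : ℝ) + α) * (k + β)),
        abs_of_pos (by positivity : (0 : ℝ) < (k + 1) * (k + γ)),
        abs_of_pos (by positivity : (0 : ℝ) < (k + α) * (k + β))] at h
    refine le_of_mul_le_mul_left ?_ hkγ
    push_cast
    have := mul_nonneg (sub_nonneg.2 hbig) (hf0 k)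
    linarith
  have hanti : ∀ k, N ≤ k → ((k + 1 : ℕ) : ℝ) * f (k + 1) ≤ k * f k := fun k hk => by
    have h1 := key k hk
    have h2 := mul_nonneg hd.le (hf0 k)
    linarith
  have hsum : Summable f := by
    rw [← summable_nat_add_iff N]
    refine summable_of_sum_range_le (c := 2 / (γ - α - β) * (N * f N)) (fun k => hf0 _) fun n => ?_
    have h1 : ∀ n : ℕ, (γ - α - β) / 2 * ∑ k ∈ Finset.range n, f (k + N) ≤
        N * f N - ((n + N : ℕ) : ℝ) * f (n + N) := by
      intro n
      induction n with
      | zero => simp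
      | succ n ih =>
        have := key (n + N) (by lia)
        rw [Finset.sum_range_succ, mul_add, show n + 1 + N = n + N + 1 by lia]
        linarith
    have h2 := h1 n
    have h3 : 0 ≤ ((n + N : ℕ) : ℝ) * f (n + N) := mul_nonneg (Nat.cast_nonneg _) (hf0 _)
    rw [div_mul_eq_mul_div, le_div_iff₀ hd]
    linarith
  exact ⟨hsum, tendsto_mul_of_summable_of_antitone hsum hf0 hanti⟩

theorem summable_ordinaryHypergeometricCoefficient {α β γ : ℝ} (hγ : 0 < γ)
    (hd : 0 < γ - α - β) : Summable (ordinaryHypergeometricCoefficient α β γ) :=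
  (ordinaryHypergeometricCoefficient_summable_and_tendsto hγ hd).1.of_abs

/-- With `γ - α - β ≤ 0`, the quantity `k` times the `k`-th coefficient is nondecreasing for `k ≥
1`, so the series dominates a multiple of the harmonic series. -/
theorem tendsto_sum_ordinaryHypergeometricCoefficient_atTop {α β γ : ℝ} (hα : 0 < α) (hβ : 0 < β)
    (hγ : 0 < γ) (hd : γ - α - β ≤ 0) :
    Tendsto (fun n : ℕ => ∑ k ∈ Finset.range n, ordinaryHypergeometricCoefficient α β γ k)
      atTop atTop := by
  have hpos := ordinaryHypergeometricCoefficient_pos hα hβ hγ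
  rw [← not_summable_iff_tendsto_nat_atTop_of_nonneg fun k => (hpos k).le]
  intro hs
  have h1 : ∀ k : ℕ, ordinaryHypergeometricCoefficient α β γ 1 ≤
      ((k + 1 : ℕ) : ℝ) * ordinaryHypergeometricCoefficient α β γ (k + 1) := by
    intro k
    induction k with
    | zero => simp
    | succ k ih =>
      refine ih.trans ?_
      have h := ordinaryHypergeometricCoefficient_succ α β hγ (k + 1)
      have hk : (0 : ℝ) < (k + 1 : ℕ) + γ := by positivity
      refine le_of_mul_le_mul_left ?_ hk
      have h2 : 0 ≤ (α * β - (γ - α - β) * (k + 1)) *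
          ordinaryHypergeometricCoefficient α β γ (k + 1) :=
        mul_nonneg (by nlinarith [mul_pos hα hβ, (k.cast_nonneg : (0 : ℝ) ≤ k)]) (hpos _).le
      push_cast at h ⊢
      linarith
  refine Real.not_summable_one_div_natCast ?_
  rw [← summable_nat_add_iff 1]
  refine Summable.of_nonneg_of_le (fun k => by positivity) (fun k => ?_)
    (((summable_nat_add_iff 1).2 hs).mul_left (ordinaryHypergeometricCoefficient α β γ 1)⁻¹)
  rw [inv_mul_eq_div, div_le_div_iff₀ (by positivity) (hpos 1)]
  linarith [h1 k]

theorem ordinaryHypergeometricCoefficient_sub_one_succ (α β : ℝ) {γ : ℝ} (hγ : 0 < γ) (k : ℕ) :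
    (k + 1) * (k + γ) * ordinaryHypergeometricCoefficient (α - 1) β γ (k + 1) =
      (α - 1) * (k + β) * ordinaryHypergeometricCoefficient α β γ k := by
  have h1 := (ascPochhammer_pos k γ hγ).ne'
  have h2 : (0 : ℝ) < γ + k := by positivity
  have h3 : (ascPochhammer ℝ (k + 1)).eval (α - 1) = (α - 1) * (ascPochhammer ℝ k).eval α := by
    rw [ascPochhammer_succ_left]; simp
  simp only [ordinaryHypergeometricCoefficient, h3]
  simp only [ascPochhammer_succ_eval, Nat.factorial_succ, Nat.cast_mul, Nat.cast_add, Nat.cast_one]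
  field_simp
  ring

/-- A contiguous relation for the hypergeometric function at `1`. -/
theorem ordinaryHypergeometric_sub_one_at_one {α β γ : ℝ} (hγ : 0 < γ) (hd : 0 < γ - α - β) :
    (γ - α) * ordinaryHypergeometric (α - 1) β γ 1 =
      (γ - α - β) * ordinaryHypergeometric α β γ 1 := by
  simp only [ordinaryHypergeometric_real_eq_tsum, one_pow, mul_one]
  obtain ⟨hs1, ht⟩ := ordinaryHypergeometricCoefficient_summable_and_tendsto hγ hd
  have hs2 := summable_ordinaryHypergeometricCoefficient (α := α - 1) (β := β) hγ (by linarith)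
  -- The relation holds for partial sums up to a boundary term, which tends to zero.
  have hpart : ∀ n : ℕ,
      (γ - α) * ∑ k ∈ Finset.range (n + 1), ordinaryHypergeometricCoefficient (α - 1) β γ k -
      (γ - α - β) * ∑ k ∈ Finset.range (n + 1), ordinaryHypergeometricCoefficient α β γ k =
      (n + β) * ordinaryHypergeometricCoefficient α β γ n := by
    intro n
    induction n with
    | zero => simp [ordinaryHypergeometricCoefficient_zero]
    | succ n ih =>
      rw [Finset.sum_range_succ, Finset.sum_range_succ _ (n + 1)]
      have h1 := ordinaryHypergeometricCoefficient_sub_one_succ α β hγ n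
      have h2 := ordinaryHypergeometricCoefficient_succ α β hγ n
      have h3 : ((n : ℝ) + 1) * (n + γ) ≠ 0 := by positivity
      apply mul_left_cancel₀ h3
      push_cast
      linear_combination (n + 1) * (n + γ) * ih + (γ - α) * h1 - (n + 1 + γ - α) * h2
  have hz : Tendsto (fun n : ℕ => (n + β) * ordinaryHypergeometricCoefficient α β γ n)
      atTop (𝓝 0) := by
    have h1 : Tendsto (fun n : ℕ => n * ordinaryHypergeometricCoefficient α β γ n)
        atTop (𝓝 0) := by
      rw [tendsto_zero_iff_abs_tendsto_zero]
      refine ht.congr fun n => ?_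
      simp [abs_mul]
    simpa [add_mul] using h1.add ((hs1.of_abs.tendsto_atTop_zero).const_mul β)
  have hlim := ((hs2.hasSum.tendsto_sum_nat.comp (tendsto_add_atTop_nat 1)).const_mul (γ - α)).sub
    ((hs1.of_abs.hasSum.tendsto_sum_nat.comp (tendsto_add_atTop_nat 1)).const_mul (γ - α - β))
  exact sub_eq_zero.1 (tendsto_nhds_unique hlim (hz.congr fun n => (hpart n).symm))

theorem tendsto_ordinaryHypergeometric_one {α β γ : ℝ} (hγ : 0 < γ) (hd : 0 < γ - α - β) :
    Tendsto (fun z : ℝ => ordinaryHypergeometric α β γ z) (𝓝[<] 1)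
      (𝓝 (ordinaryHypergeometric α β γ 1)) := by
  simp only [ordinaryHypergeometric_real_eq_tsum, one_pow, mul_one]
  exact Real.tendsto_tsum_powerSeries_nhdsWithin_lt
    (summable_ordinaryHypergeometricCoefficient hγ hd).hasSum.tendsto_sum_nat

end HypergeometricAnalytic

/-! ### Signed powers and Gaussian moments -/

section Moments

open scoped Topology

theorem measurable_real_sign : Measurable Real.sign := by
  unfold Real.sign
  exact Measurable.ite measurableSet_Iio measurable_const
    (Measurable.ite measurableSet_Ioi measurable_const measurable_const)

@[fun_prop]
theorem measurable_signedPow (c : ℝ) : Measurable (signedPow c) :=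
  measurable_real_sign.mul (measurable_id.abs.pow_const c)

theorem signedPow_neg (c t : ℝ) : signedPow c (-t) = -signedPow c t := by
  simp [signedPow, Real.sign_neg]

theorem real_sign_mul_self {t : ℝ} (ht : t ≠ 0) : Real.sign t * Real.sign t = 1 := by
  rcases Real.sign_apply_eq_of_ne_zero t ht with h | h <;> simp [h]

theorem abs_real_sign_le (t : ℝ) : |Real.sign t| ≤ 1 := by
  rcases Real.sign_apply_eq t with h | h | h <;> simp [h]

theorem real_sign_mul_abs (t : ℝ) : Real.sign t * |t| = t := by
  rcases lt_trichotomy t 0 with h | rfl | h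
  · simp [Real.sign_of_neg h, abs_of_neg h]
  · simp
  · simp [Real.sign_of_pos h, abs_of_pos h]

theorem abs_signedPow_le (c t : ℝ) : |signedPow c t| ≤ |t| ^ c := by
  rw [signedPow, abs_mul, abs_of_nonneg (Real.rpow_nonneg (abs_nonneg t) c)]
  exact mul_le_of_le_one_left (Real.rpow_nonneg (abs_nonneg t) c) (abs_real_sign_le t)

theorem signedPow_mul_signedPow {t : ℝ} (ht : t ≠ 0) (a b : ℝ) :
    signedPow a t * signedPow b t = |t| ^ (a + b) := by
  rw [Real.rpow_add (abs_pos.2 ht), signedPow, signedPow]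
  linear_combination |t| ^ a * |t| ^ b * real_sign_mul_self ht

theorem signedPow_mul_pow_odd {a : ℝ} (ha : -1 < a) (t : ℝ) (k : ℕ) :
    signedPow a t * t ^ (2 * k + 1) = |t| ^ (a + 1 + 2 * k) := by
  rcases eq_or_ne t 0 with rfl | ht
  -- Since `0 ^ 0 = 1` for real powers, the case `t = 0` needs a nonzero exponent.
  · have : a + 1 + 2 * k ≠ 0 := by
      have : (0 : ℝ) ≤ k := k.cast_nonneg
      linarith
    simp [Real.zero_rpow this]
  · have h1 : t ^ (2 * k + 1) = Real.sign t * |t| * |t| ^ (2 * k) := by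
      rw [real_sign_mul_abs, pow_succ, pow_mul, pow_mul, sq_abs]; ring
    have h2 : |t| ^ (a + 1 + 2 * k) = |t| ^ a * |t| * |t| ^ (2 * k) := by
      rw [Real.rpow_add (abs_pos.2 ht), Real.rpow_add_one (abs_pos.2 ht).ne']
      congr 1
      rw [← Real.rpow_natCast]; push_cast; rfl
    rw [h1, h2, signedPow]
    linear_combination |t| ^ a * |t| * |t| ^ (2 * k) * real_sign_mul_self ht

theorem integral_abs_rpow_mul_exp_neg_mul_sq {c q : ℝ} (hc : 0 < c) (hq : -1 < q) :
    ∫ x : ℝ, |x| ^ q * Real.exp (-c * x ^ 2) =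
      c ^ (-(q + 1) / 2) * Real.Gamma ((q + 1) / 2) := by
  have h := integral_rpow_mul_exp_neg_mul_rpow two_pos hq hc
  have h2 := integral_comp_abs (f := fun x : ℝ => x ^ q * Real.exp (-c * x ^ (2 : ℝ)))
  simp only [Real.rpow_two, sq_abs] at h h2
  rw [h2, h]
  ring

theorem integrable_abs_rpow_mul_exp_neg_mul_sq {c q : ℝ} (hc : 0 < c) (hq : -1 < q) :
    Integrable fun x : ℝ => |x| ^ q * Real.exp (-c * x ^ 2) := by
  -- A nonintegrable function has integral `0` by convention, so a nonzero value proves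
  -- integrability.
  refine Integrable.of_integral_ne_zero ?_
  rw [integral_abs_rpow_mul_exp_neg_mul_sq hc hq]
  have := Real.Gamma_pos_of_pos (show 0 < (q + 1) / 2 by linarith)
  positivity

theorem Gamma_add_nat_eq_ascPochhammer {x : ℝ} (hx : 0 < x) (n : ℕ) :
    Real.Gamma (x + n) = (ascPochhammer ℝ n).eval x * Real.Gamma x := by
  induction n with
  | zero => simp
  | succ n ih =>
    push_cast
    rw [← add_assoc, Real.Gamma_add_one (by positivity), ih, ascPochhammer_succ_eval]
    ring

theorem integral_abs_rpow_add_two_mul_exp_neg_mul_sq {c q : ℝ} (hc : 0 < c) (hq : -1 < q)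
    (k : ℕ) :
    ∫ x : ℝ, |x| ^ (q + 2 * k) * Real.exp (-c * x ^ 2) =
      (ascPochhammer ℝ k).eval ((q + 1) / 2) * (c ^ k)⁻¹ *
        ∫ x : ℝ, |x| ^ q * Real.exp (-c * x ^ 2) := by
  have hk : (0 : ℝ) ≤ k := k.cast_nonneg
  rw [integral_abs_rpow_mul_exp_neg_mul_sq hc (by linarith),
    integral_abs_rpow_mul_exp_neg_mul_sq hc hq,
    show (q + 2 * k + 1) / 2 = (q + 1) / 2 + k by ring,
    Gamma_add_nat_eq_ascPochhammer (by linarith),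
    show -(q + 2 * k + 1) / 2 = -(q + 1) / 2 + -k by ring, Real.rpow_add hc, Real.rpow_neg hc.le,
    Real.rpow_natCast]
  ring

theorem integral_gaussianReal_standard (f : ℝ → ℝ) :
    ∫ x, f x ∂(gaussianReal 0 1) =
      (√(2 * Real.pi))⁻¹ * ∫ x : ℝ, f x * Real.exp (-(1 / 2) * x ^ 2) := by
  rw [integral_gaussianReal_eq_integral_smul one_ne_zero, ← integral_const_mul]
  refine integral_congr_ae (ae_of_all _ fun x => ?_)
  simp only [gaussianPDFReal, NNReal.coe_one, smul_eq_mul, mul_one, sub_zero]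
  rw [show -x ^ 2 / 2 = -(1 / 2) * x ^ 2 by ring]
  ring

theorem integral_abs_rpow_gaussianReal {q : ℝ} (hq : -1 < q) :
    ∫ x, |x| ^ q ∂(gaussianReal 0 1) = (√(2 * Real.pi))⁻¹ *
      ((1 / 2 : ℝ) ^ (-(q + 1) / 2) * Real.Gamma ((q + 1) / 2)) := by
  rw [integral_gaussianReal_standard, integral_abs_rpow_mul_exp_neg_mul_sq (by norm_num) hq]

theorem integral_abs_rpow_gaussianReal_pos {q : ℝ} (hq : -1 < q) :
    0 < ∫ x, |x| ^ q ∂(gaussianReal 0 1) := by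
  rw [integral_abs_rpow_gaussianReal hq]
  have := Real.Gamma_pos_of_pos (show 0 < (q + 1) / 2 by linarith)
  positivity

theorem integrable_abs_rpow_gaussianReal {q : ℝ} (hq : -1 < q) :
    Integrable (fun x => |x| ^ q) (gaussianReal 0 1) :=
  Integrable.of_integral_ne_zero (integral_abs_rpow_gaussianReal_pos hq).ne'

theorem integral_abs_rpow_add_two_gaussianReal {q : ℝ} (hq : -1 < q) :
    ∫ x, |x| ^ (q + 2) ∂(gaussianReal 0 1) = (q + 1) * ∫ x, |x| ^ q ∂(gaussianReal 0 1) := by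
  have h := integral_abs_rpow_add_two_mul_exp_neg_mul_sq (c := 1 / 2) (by norm_num) hq 1
  rw [integral_gaussianReal_standard, integral_gaussianReal_standard]
  norm_num at h ⊢
  rw [h]
  ring

/-- Rescaling by `√u` isolates the standard moment, which the normalization later cancels. -/
theorem integral_abs_rpow_mul_exp_eq_integral_gaussianReal {u q : ℝ} (hu : 0 < u) (hq : -1 < q) :
    ∫ x : ℝ, |x| ^ q * Real.exp (-(1 / (2 * u)) * x ^ 2) =
      √(2 * Real.pi) * u ^ ((q + 1) / 2) * ∫ x, |x| ^ q ∂(gaussianReal 0 1) := by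
  rw [integral_abs_rpow_gaussianReal hq, integral_abs_rpow_mul_exp_neg_mul_sq (by positivity) hq,
    show 1 / (2 * u) = 1 / 2 * u⁻¹ by field_simp, Real.mul_rpow (by norm_num) (by positivity),
    Real.inv_rpow hu.le, ← Real.rpow_neg hu.le, show -(-(q + 1) / 2) = (q + 1) / 2 by ring]
  field_simp

theorem gaussianNorm_rpow {r : ℝ} (hr : 0 < r) :
    gaussianNorm r ^ r = ∫ x, |x| ^ r ∂(gaussianReal 0 1) := by
  rw [gaussianNorm, ← Real.rpow_mul (integral_abs_rpow_gaussianReal_pos (by linarith)).le,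
    one_div_mul_cancel hr.ne', Real.rpow_one]

theorem normalizedCorrelation_eq {a b : ℝ} (ha : -1 < a) (hb : -1 < b) (ρ : ℝ) :
    normalizedCorrelation a b ρ =
      (∫ z, signedPow a z.1 * signedPow b z.2 ∂(correlatedGaussian ρ)) /
        ((∫ x, |x| ^ (a + 1) ∂(gaussianReal 0 1)) * ∫ x, |x| ^ (b + 1) ∂(gaussianReal 0 1)) := by
  rw [normalizedCorrelation, gaussianNorm_rpow (by linarith), gaussianNorm_rpow (by linarith)]
  ring

theorem integral_signedPow_mul_pow_even (a c : ℝ) (k : ℕ) :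
    ∫ t : ℝ, signedPow a t * t ^ (2 * k) * Real.exp (-c * t ^ 2) = 0 := by
  have h := integral_neg_eq_self
    (fun t : ℝ => signedPow a t * t ^ (2 * k) * Real.exp (-c * t ^ 2)) volume
  simp only [signedPow_neg, Even.neg_pow (even_two_mul k), neg_sq, neg_mul, integral_neg] at h
  simp only [neg_mul]
  linarith

end Moments

/-! ### The joint density -/

section Density

open scoped ENNReal

/-- The density of a pair of `ρ`-correlated standard Gaussians. -/
noncomputable def correlatedGaussianDensity (ρ : ℝ) (z : ℝ × ℝ) : ℝ :=
  (2 * Real.pi * √(1 - ρ ^ 2))⁻¹ *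
    Real.exp (-(z.1 ^ 2 - 2 * ρ * z.1 * z.2 + z.2 ^ 2) / (2 * (1 - ρ ^ 2)))

theorem correlatedGaussianDensity_nonneg (ρ : ℝ) (z : ℝ × ℝ) :
    0 ≤ correlatedGaussianDensity ρ z := by
  unfold correlatedGaussianDensity; positivity

@[fun_prop]
theorem measurable_correlatedGaussianDensity (ρ : ℝ) :
    Measurable (correlatedGaussianDensity ρ) := by
  unfold correlatedGaussianDensity; fun_prop

theorem correlatedGaussian_eq_withDensity {ρ : ℝ} (hρ : |ρ| < 1) :
    correlatedGaussian ρ =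
      volume.withDensity fun z => ENNReal.ofReal (correlatedGaussianDensity ρ z) := by
  have hu : 0 < 1 - ρ ^ 2 := by
    have := (sq_lt_one_iff_abs_lt_one ρ).2 hρ
    linarith
  obtain ⟨v, hv⟩ : ∃ v : NNReal, (v : ℝ) = 1 - ρ ^ 2 :=
    ⟨Real.toNNReal (1 - ρ ^ 2), Real.coe_toNNReal _ hu.le⟩
  have hv0 : v ≠ 0 := by
    rintro rfl
    exact hu.ne hv
  refine Measure.ext_of_lintegral _ fun f hf => ?_
  rw [correlatedGaussian, lintegral_map hf (by fun_prop), lintegral_prod _ (by fun_prop),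
    lintegral_withDensity_eq_lintegral_mul _ (by fun_prop) hf, Measure.volume_eq_prod,
    lintegral_prod_symm _ (by fun_prop)]
  -- Given `g₂ = x`, the conditional law of `g₁` is Gaussian with mean `ρ x` and variance `1 - ρ²`.
  have hmap : ∀ x : ℝ, (gaussianReal 0 1).map (fun y => ρ * x + √(1 - ρ ^ 2) * y) =
      gaussianReal (ρ * x) v := by
    intro x
    have h1 := gaussianReal_map_const_mul (μ := 0) (v := 1) (√(1 - ρ ^ 2))
    have h2 := gaussianReal_map_const_add (μ := 0) (v := v) (ρ * x)
    have h3 : (NNReal.mk (√(1 - ρ ^ 2) ^ 2) (sq_nonneg _) * 1) = v := by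
      ext; simp [Real.sq_sqrt hu.le, hv]
    rw [mul_zero, h3] at h1
    rw [← h1, Measure.map_map (by fun_prop) (by fun_prop), zero_add] at h2
    exact h2
  have hin : ∀ x : ℝ, ∫⁻ y, f (ρ * x + √(1 - ρ ^ 2) * y, x) ∂(gaussianReal 0 1) =
      ∫⁻ t, gaussianPDF (ρ * x) v t * f (t, x) := by
    intro x
    have h := lintegral_map (μ := gaussianReal 0 1) (f := fun t => f (t, x))
      (g := fun y => ρ * x + √(1 - ρ ^ 2) * y) (by fun_prop) (by fun_prop)
    rw [← h, hmap, gaussianReal_of_var_ne_zero _ hv0,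
      lintegral_withDensity_eq_lintegral_mul _ (measurable_gaussianPDF _ _) (by fun_prop)]
    rfl
  simp_rw [hin]
  have hmeas : Measurable fun p : ℝ × ℝ =>
      gaussianPDF (ρ * p.1) v p.2 * f (p.2, p.1) := by
    refine Measurable.mul ?_ (by fun_prop)
    unfold gaussianPDF gaussianPDFReal
    fun_prop
  rw [gaussianReal_of_var_ne_zero _ one_ne_zero,
    lintegral_withDensity_eq_lintegral_mul _ (measurable_gaussianPDF _ _)
      hmeas.lintegral_prod_right']
  refine lintegral_congr fun x => ?_
  rw [Pi.mul_apply, ← lintegral_const_mul _ (by exact hmeas.comp measurable_prodMk_left)]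
  refine lintegral_congr fun t => ?_
  rw [Pi.mul_apply, ← mul_assoc, gaussianPDF_def, gaussianPDF_def,
    ← ENNReal.ofReal_mul (gaussianPDFReal_nonneg _ _ _)]
  congr 2
  simp only [gaussianPDFReal, correlatedGaussianDensity, NNReal.coe_one, mul_one, sub_zero, hv]
  rw [mul_mul_mul_comm, ← Real.exp_add, ← mul_inv, Real.sqrt_mul (by positivity) (1 - ρ ^ 2),
    ← mul_assoc, Real.mul_self_sqrt (by positivity)]
  congr 2
  field_simp
  ring

theorem integral_correlatedGaussian {ρ : ℝ} (hρ : |ρ| < 1) (f : ℝ × ℝ → ℝ) :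
    ∫ z, f z ∂(correlatedGaussian ρ) = ∫ z, correlatedGaussianDensity ρ z * f z := by
  rw [correlatedGaussian_eq_withDensity hρ, integral_withDensity_eq_integral_toReal_smul
    (by fun_prop) (ae_of_all _ fun _ => ENNReal.ofReal_lt_top)]
  simp_rw [ENNReal.toReal_ofReal (correlatedGaussianDensity_nonneg ρ _), smul_eq_mul]

theorem integrable_correlatedGaussian {ρ : ℝ} (hρ : |ρ| < 1) {f : ℝ × ℝ → ℝ}
    (hf : Integrable fun z => correlatedGaussianDensity ρ z * f z) :
    Integrable f (correlatedGaussian ρ) := by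
  rw [correlatedGaussian_eq_withDensity hρ, integrable_withDensity_iff_integrable_smul'
    (by fun_prop) (ae_of_all _ fun _ => ENNReal.ofReal_lt_top)]
  simpa only [ENNReal.toReal_ofReal (correlatedGaussianDensity_nonneg ρ _), smul_eq_mul] using hf

end Density

/-! ### Expansion of the correlation in powers of `ρ` -/

section Expansion

open scoped Topology

/-- A Gaussian-type majorant of the terms in the expansion of the correlation. -/
theorem integrable_majorant {a b c r : ℝ} (ha : -1 < a) (hb : -1 < b) (hc : 0 < c) (hr : 0 ≤ r)
    (hr1 : r < 1) :
    Integrable fun z : ℝ × ℝ => |z.1| ^ a * Real.exp (-c * z.1 ^ 2) *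
      (|z.2| ^ b * Real.exp (-c * z.2 ^ 2)) * Real.exp (2 * c * r * |z.1| * |z.2|) := by
  have hc' : 0 < c * (1 - r) := mul_pos hc (by linarith)
  have h := (integrable_abs_rpow_mul_exp_neg_mul_sq hc' ha).mul_prod
    (integrable_abs_rpow_mul_exp_neg_mul_sq hc' hb)
  refine Integrable.mono' h (by fun_prop) (ae_of_all _ fun z => ?_)
  have h1 : 0 ≤ |z.1| ^ a := Real.rpow_nonneg (abs_nonneg _) _
  have h2 : 0 ≤ |z.2| ^ b := Real.rpow_nonneg (abs_nonneg _) _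
  rw [Real.norm_of_nonneg (by positivity)]
  calc _ = |z.1| ^ a * |z.2| ^ b *
        Real.exp (-c * z.1 ^ 2 + -c * z.2 ^ 2 + 2 * c * r * |z.1| * |z.2|) := by
        rw [Real.exp_add, Real.exp_add]; ring
    _ ≤ |z.1| ^ a * |z.2| ^ b *
        Real.exp (-(c * (1 - r)) * z.1 ^ 2 + -(c * (1 - r)) * z.2 ^ 2) := by
        refine mul_le_mul_of_nonneg_left (Real.exp_le_exp.2 ?_) (by positivity)
        -- This is `2|x||y| ≤ x² + y²`, which absorbs the cross term at the cost of the factor `1 -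
        -- r`.
        have h3 := mul_nonneg (mul_nonneg hc.le hr) (sq_nonneg (|z.1| - |z.2|))
        have h4 := sq_abs z.1
        have h5 := sq_abs z.2
        linear_combination h3 + c * r * h4 + c * r * h5
    _ = _ := by rw [Real.exp_add]; ring

theorem correlatedGaussianDensity_eq {ρ : ℝ} (hρ : |ρ| < 1) (z : ℝ × ℝ) :
    correlatedGaussianDensity ρ z = (2 * Real.pi * √(1 - ρ ^ 2))⁻¹ *
      (Real.exp (-(1 / (2 * (1 - ρ ^ 2))) * z.1 ^ 2) *
        Real.exp (-(1 / (2 * (1 - ρ ^ 2))) * z.2 ^ 2) *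
        Real.exp (2 * (1 / (2 * (1 - ρ ^ 2))) * ρ * z.1 * z.2)) := by
  have hu : 1 - ρ ^ 2 ≠ 0 := by
    have := (sq_lt_one_iff_abs_lt_one ρ).2 hρ
    linarith
  rw [correlatedGaussianDensity, ← Real.exp_add, ← Real.exp_add]
  congr 2
  field_simp
  ring

theorem hasSum_exp (x : ℝ) : HasSum (fun n : ℕ => x ^ n / n.factorial) (Real.exp x) := by
  rw [Real.exp_eq_exp_ℝ]
  exact NormedSpace.expSeries_div_hasSum_exp x

theorem integrable_density_mul_signedPow {a b ρ : ℝ} (ha : -1 < a) (hb : -1 < b)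
    (hρ : |ρ| < 1) :
    Integrable fun z => correlatedGaussianDensity ρ z * (signedPow a z.1 * signedPow b z.2) := by
  have hu : 0 < 1 - ρ ^ 2 := by
    have := (sq_lt_one_iff_abs_lt_one ρ).2 hρ
    linarith
  have hc : 0 < 1 / (2 * (1 - ρ ^ 2)) := by positivity
  refine Integrable.mono' ((integrable_majorant ha hb hc (abs_nonneg ρ) hρ).const_mul
    (2 * Real.pi * √(1 - ρ ^ 2))⁻¹) (by fun_prop) (ae_of_all _ fun z => ?_)
  rw [correlatedGaussianDensity_eq hρ]
  set c := 1 / (2 * (1 - ρ ^ 2))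
  have h3 : Real.exp (2 * c * ρ * z.1 * z.2) ≤ Real.exp (2 * c * |ρ| * |z.1| * |z.2|) := by
    rw [Real.exp_le_exp]
    refine (le_abs_self _).trans_eq ?_
    rw [abs_mul, abs_mul, abs_mul, abs_of_pos (by positivity : 0 < 2 * c)]
  rw [norm_mul, norm_mul, norm_mul, norm_mul, Real.norm_of_nonneg (by positivity),
    Real.norm_of_nonneg (Real.exp_nonneg _), norm_mul, Real.norm_of_nonneg (Real.exp_nonneg _),
    Real.norm_of_nonneg (Real.exp_nonneg _)]
  calc _ ≤ (2 * Real.pi * √(1 - ρ ^ 2))⁻¹ * (Real.exp (-c * z.1 ^ 2) * Real.exp (-c * z.2 ^ 2) *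
        Real.exp (2 * c * |ρ| * |z.1| * |z.2|)) * (|z.1| ^ a * |z.2| ^ b) := by
        gcongr
        · exact abs_signedPow_le _ _
        · exact abs_signedPow_le _ _
    _ = _ := by ring

/-- Only the cross factor of the density is expanded. The absolute values of the terms are bounded
by the same expansion with `|ρ|`, whose sum is the integrable majorant; Fubini then factors each
term. -/
theorem hasSum_integral_density_mul_signedPow {a b ρ : ℝ} (ha : -1 < a) (hb : -1 < b)
    (hρ : |ρ| < 1) :
    HasSum (fun n : ℕ => (2 * Real.pi * √(1 - ρ ^ 2))⁻¹ *
        ((2 * (1 / (2 * (1 - ρ ^ 2))) * ρ) ^ n / n.factorial) *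
        ((∫ t : ℝ, signedPow a t * t ^ n * Real.exp (-(1 / (2 * (1 - ρ ^ 2))) * t ^ 2)) *
        ∫ t : ℝ, signedPow b t * t ^ n * Real.exp (-(1 / (2 * (1 - ρ ^ 2))) * t ^ 2)))
      (∫ z, correlatedGaussianDensity ρ z * (signedPow a z.1 * signedPow b z.2)) := by
  have hu : 0 < 1 - ρ ^ 2 := by
    have := (sq_lt_one_iff_abs_lt_one ρ).2 hρ
    linarith
  have hc : 0 < 1 / (2 * (1 - ρ ^ 2)) := by positivity
  simp_rw [correlatedGaussianDensity_eq hρ]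
  set c := 1 / (2 * (1 - ρ ^ 2))
  set K := (2 * Real.pi * √(1 - ρ ^ 2))⁻¹
  have hK : 0 ≤ K := by positivity
  simp_rw [← integral_prod_mul, ← integral_const_mul, ← Measure.volume_eq_prod]
  have hbound : ∀ z : ℝ × ℝ, HasSum (fun n : ℕ => K * (|z.1| ^ a * Real.exp (-c * z.1 ^ 2) *
      (|z.2| ^ b * Real.exp (-c * z.2 ^ 2))) * ((2 * c * |ρ| * |z.1| * |z.2|) ^ n / n.factorial))
      (K * (|z.1| ^ a * Real.exp (-c * z.1 ^ 2) *
      (|z.2| ^ b * Real.exp (-c * z.2 ^ 2)) * Real.exp (2 * c * |ρ| * |z.1| * |z.2|))) := by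
    intro z
    convert! (hasSum_exp (2 * c * |ρ| * |z.1| * |z.2|)).mul_left
      (K * (|z.1| ^ a * Real.exp (-c * z.1 ^ 2) * (|z.2| ^ b * Real.exp (-c * z.2 ^ 2)))) using 1
    ring
  refine hasSum_integral_of_dominated_convergence
    (fun (n : ℕ) (z : ℝ × ℝ) => K * (|z.1| ^ a * Real.exp (-c * z.1 ^ 2) *
      (|z.2| ^ b * Real.exp (-c * z.2 ^ 2))) * ((2 * c * |ρ| * |z.1| * |z.2|) ^ n / n.factorial))
    (fun n => by fun_prop) (fun n => ae_of_all _ fun z => ?_)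
    (ae_of_all _ fun z => (hbound z).summable) ?_ (ae_of_all _ fun z => ?_)
  · have h1 := abs_signedPow_le a z.1
    have h2 := abs_signedPow_le b z.2
    have h3 : |2 * c * ρ| = 2 * c * |ρ| := by
      rw [abs_mul, abs_of_pos (by positivity : 0 < 2 * c)]
    simp only [Real.norm_eq_abs, abs_mul, abs_div, abs_pow, abs_of_nonneg hK, Real.abs_exp,
      Nat.abs_cast, abs_of_pos hc, abs_two]
    calc _ ≤ K * ((2 * c * |ρ|) ^ n / n.factorial) *
        (|z.1| ^ a * |z.1| ^ n * Real.exp (-c * z.1 ^ 2) *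
          (|z.2| ^ b * |z.2| ^ n * Real.exp (-c * z.2 ^ 2))) := by gcongr
      _ = _ := by rw [mul_pow _ |z.2|, mul_pow _ |z.1|]; ring
  · simp_rw [fun z => (hbound z).tsum_eq]
    exact (integrable_majorant ha hb hc (abs_nonneg ρ) hρ).const_mul K
  · have h := (hasSum_exp (2 * c * ρ * z.1 * z.2)).mul_left
      (K * (Real.exp (-c * z.1 ^ 2) * Real.exp (-c * z.2 ^ 2)) *
        (signedPow a z.1 * signedPow b z.2))
    convert! h using 1
    · ext n
      rw [mul_pow _ z.2, mul_pow _ z.1]; ring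
    · ring

/-- The source of the lower parameter `3/2`: only odd terms of the exponential series survive. -/
theorem factorial_two_mul_add_one (k : ℕ) :
    ((2 * k + 1).factorial : ℝ) =
      4 ^ k * k.factorial * (ascPochhammer ℝ k).eval (3 / 2) := by
  induction k with
  | zero => simp
  | succ k ih =>
    rw [show 2 * (k + 1) + 1 = 2 * k + 1 + 1 + 1 by ring, Nat.factorial_succ, Nat.factorial_succ,
      Nat.factorial_succ k, ascPochhammer_succ_eval]
    push_cast
    rw [ih]
    ring

theorem integral_signedPow_mul_pow_odd {a u : ℝ} (ha : -1 < a) (hu : 0 < u) (k : ℕ) :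
    ∫ t : ℝ, signedPow a t * t ^ (2 * k + 1) * Real.exp (-(1 / (2 * u)) * t ^ 2) =
      (ascPochhammer ℝ k).eval (1 + a / 2) * (2 * u) ^ k *
        (√(2 * Real.pi) * u ^ (1 + a / 2) * ∫ x, |x| ^ (a + 1) ∂(gaussianReal 0 1)) := by
  simp_rw [signedPow_mul_pow_odd ha]
  rw [integral_abs_rpow_add_two_mul_exp_neg_mul_sq (by positivity) (by linarith),
    integral_abs_rpow_mul_exp_eq_integral_gaussianReal hu (by linarith),
    show (a + 1 + 1) / 2 = 1 + a / 2 by ring, ← inv_pow, one_div, inv_inv]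

theorem integral_signedPow_correlatedGaussian {a b ρ : ℝ} (ha : -1 < a) (hb : -1 < b)
    (hρ : |ρ| < 1) :
    ∫ z, signedPow a z.1 * signedPow b z.2 ∂(correlatedGaussian ρ) =
      (∫ x, |x| ^ (a + 1) ∂(gaussianReal 0 1)) * (∫ x, |x| ^ (b + 1) ∂(gaussianReal 0 1)) *
        (ρ * ordinaryHypergeometric ((1 - a) / 2) ((1 - b) / 2) (3 / 2 : ℝ) (ρ ^ 2)) := by
  have hu : 0 < 1 - ρ ^ 2 := by
    have := (sq_lt_one_iff_abs_lt_one ρ).2 hρ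
    linarith
  have hρ2 : |ρ ^ 2| < 1 := by
    rw [abs_of_nonneg (sq_nonneg ρ)]; linarith
  rw [integral_correlatedGaussian hρ, ordinaryHypergeometric_euler _ _ (by norm_num) hρ2]
  have h := hasSum_integral_density_mul_signedPow ha hb hρ
  have hinj : Function.Injective fun k : ℕ => 2 * k + 1 := fun i j hij => by
    simp only at hij; lia
  rw [← hinj.hasSum_iff] at h
  · rw [ordinaryHypergeometric_real_eq_tsum, ← tsum_mul_left, ← tsum_mul_left, ← tsum_mul_left,
      ← h.tsum_eq]
    refine tsum_congr fun k => ?_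
    rw [Function.comp_apply, integral_signedPow_mul_pow_odd ha hu,
      integral_signedPow_mul_pow_odd hb hu, factorial_two_mul_add_one,
      -- Powers of `u`: each moment contributes `1 + a/2` or `1 + b/2`, the density contributes
      -- `-1/2`, and `(ρ/u)^(2k+1)` against `u^k * u^k` contributes `-1`.
      show 3 / 2 - (1 - a) / 2 - (1 - b) / 2 = (1 + a / 2) + (1 + b / 2) - 1 - 1 / 2 by ring,
      show 3 / 2 - (1 - a) / 2 = 1 + a / 2 by ring, show 3 / 2 - (1 - b) / 2 = 1 + b / 2 by ring,
      Real.rpow_sub hu, Real.rpow_sub_one hu.ne', Real.rpow_add hu (1 + a / 2),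
      ← Real.sqrt_eq_rpow, show 2 * (1 / (2 * (1 - ρ ^ 2))) * ρ = ρ / (1 - ρ ^ 2) by field_simp]
    have h1 := (ascPochhammer_pos k (3 / 2 : ℝ) (by norm_num)).ne'
    have h2 : √(2 * Real.pi) * √(2 * Real.pi) = 2 * Real.pi :=
      Real.mul_self_sqrt (by positivity)
    have h3 : (4 : ℝ) ^ k = 2 ^ k * 2 ^ k := by rw [← mul_pow]; norm_num
    simp only [ordinaryHypergeometricCoefficient]
    have h4 : ∀ x : ℝ, x ^ (2 * k + 1) = x ^ k * x ^ k * x := fun x => by ring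
    rw [h3, h4, div_pow, mul_pow 2, show (ρ ^ 2) ^ k = ρ ^ k * ρ ^ k by ring]
    generalize 1 - ρ ^ 2 = u at hu
    generalize √(2 * Real.pi) = s2 at h2
    have h5 : √u ≠ 0 := (Real.sqrt_pos.2 hu).ne'
    field_simp
    rw [pow_two s2, h2]
    ring
  · intro n hn
    obtain ⟨k, rfl | rfl⟩ := Nat.even_or_odd' n
    · rw [integral_signedPow_mul_pow_even, zero_mul, mul_zero]
    · exact absurd ⟨k, rfl⟩ hn

end Expansion

/-! ### The endpoints `ρ = ±1` -/

section Endpoints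

open scoped Topology

theorem ae_ne_zero_gaussianReal : ∀ᵐ x ∂(gaussianReal 0 1), x ≠ 0 :=
  (gaussianReal_absolutelyContinuous 0 one_ne_zero).ae_le (Measure.ae_ne volume 0)

theorem correlatedGaussian_of_abs_eq_one {ρ : ℝ} (hρ : |ρ| = 1) :
    correlatedGaussian ρ = (gaussianReal 0 1).map fun x => (ρ * x, x) := by
  have h : ρ ^ 2 = 1 := by rw [← sq_abs, hρ, one_pow]
  have h1 : (gaussianReal 0 1) =
      ((gaussianReal 0 1).prod (gaussianReal 0 1)).map (Prod.fst : ℝ × ℝ → ℝ) := by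
    rw [Measure.map_fst_prod, measure_univ, one_smul]
  conv_rhs => rw [h1]
  rw [Measure.map_map (by fun_prop) (by fun_prop), correlatedGaussian]
  congr 1
  ext z <;> simp [h]

theorem signedPow_mul_left {ρ : ℝ} (hρ : |ρ| = 1) (a x : ℝ) :
    signedPow a (ρ * x) = ρ * signedPow a x := by
  rcases eq_or_eq_neg_of_abs_eq hρ with rfl | rfl
  · simp
  · simp [signedPow_neg]

theorem ae_signedPow_mul_signedPow (a b : ℝ) {ρ : ℝ} (hρ : |ρ| = 1) :
    (fun x => signedPow a (ρ * x) * signedPow b x) =ᵐ[gaussianReal 0 1]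
      fun x => ρ * |x| ^ (a + b) := by
  filter_upwards [ae_ne_zero_gaussianReal] with x hx
  rw [signedPow_mul_left hρ, mul_assoc, signedPow_mul_signedPow hx]

theorem integrable_signedPow_of_abs_eq_one {a b ρ : ℝ} (hab : -1 < a + b) (hρ : |ρ| = 1) :
    Integrable (fun z : ℝ × ℝ => signedPow a z.1 * signedPow b z.2) (correlatedGaussian ρ) := by
  rw [correlatedGaussian_of_abs_eq_one hρ, integrable_map_measure
    (Measurable.aestronglyMeasurable (by fun_prop)) (by fun_prop)]
  exact ((integrable_abs_rpow_gaussianReal hab).const_mul ρ).congr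
    (ae_signedPow_mul_signedPow a b hρ).symm

theorem integral_signedPow_of_abs_eq_one (a b : ℝ) {ρ : ℝ} (hρ : |ρ| = 1) :
    ∫ z, signedPow a z.1 * signedPow b z.2 ∂(correlatedGaussian ρ) =
      ρ * ∫ x, |x| ^ (a + b) ∂(gaussianReal 0 1) := by
  rw [correlatedGaussian_of_abs_eq_one hρ, integral_map (by fun_prop)
    (Measurable.aestronglyMeasurable (by fun_prop)),
    integral_congr_ae (ae_signedPow_mul_signedPow a b hρ), integral_const_mul]

theorem ae_mul_signedPow_nonneg (a b : ℝ) {ρ : ℝ} (hρ : |ρ| = 1) :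
    ∀ᵐ z ∂(correlatedGaussian ρ), 0 ≤ ρ * (signedPow a z.1 * signedPow b z.2) := by
  rw [correlatedGaussian_of_abs_eq_one hρ, ae_map_iff (by fun_prop)
    (measurableSet_le (by fun_prop) (by fun_prop))]
  filter_upwards [ae_signedPow_mul_signedPow a b hρ] with x hx
  rw [hx, ← mul_assoc]
  exact mul_nonneg (mul_self_nonneg ρ) (Real.rpow_nonneg (abs_nonneg x) _)

/-- On `(0, 1)` the density is at least its value at `1`, so integrability would pass to `x ^ s`
there. -/
theorem not_integrable_abs_rpow_gaussianReal {s : ℝ} (hs : s ≤ -1) :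
    ¬ Integrable (fun x => |x| ^ s) (gaussianReal 0 1) := by
  intro h
  rw [gaussianReal_of_var_ne_zero _ one_ne_zero, integrable_withDensity_iff_integrable_smul'
    (measurable_gaussianPDF _ _) (ae_of_all _ fun _ => gaussianPDF_lt_top)] at h
  simp only [toReal_gaussianPDF, smul_eq_mul] at h
  refine hs.not_gt ((intervalIntegral.integrableOn_Ioo_rpow_iff one_pos).1 ?_)
  refine Integrable.mono' (h.integrableOn.const_mul (gaussianPDFReal 0 1 1)⁻¹)
    (Measurable.aestronglyMeasurable (by fun_prop)) ?_
  filter_upwards [ae_restrict_mem measurableSet_Ioo] with x hx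
  have h1 : 0 < gaussianPDFReal 0 1 1 := gaussianPDFReal_pos _ _ _ one_ne_zero
  have h2 : gaussianPDFReal 0 1 1 ≤ gaussianPDFReal 0 1 x := by
    simp only [gaussianPDFReal, sub_zero]
    gcongr
    exacts [hx.1.le, hx.2.le]
  rw [Real.norm_of_nonneg (Real.rpow_nonneg hx.1.le _), abs_of_pos hx.1, ← mul_assoc,
    inv_mul_eq_div]
  exact le_mul_of_one_le_left (Real.rpow_nonneg hx.1.le _) ((one_le_div₀ h1).2 h2)

theorem lintegral_mul_signedPow_eq_top {a b ρ : ℝ} (hab : a + b ≤ -1) (hρ : |ρ| = 1) :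
    ∫⁻ z, ENNReal.ofReal (ρ * (signedPow a z.1 * signedPow b z.2)) ∂(correlatedGaussian ρ) =
      ⊤ := by
  by_contra h
  refine not_integrable_abs_rpow_gaussianReal hab ?_
  have hm : AEStronglyMeasurable (fun z : ℝ × ℝ => ρ * (signedPow a z.1 * signedPow b z.2))
    (correlatedGaussian ρ) := Measurable.aestronglyMeasurable (by fun_prop)
  have hi : Integrable (fun z : ℝ × ℝ => ρ * (signedPow a z.1 * signedPow b z.2))
      (correlatedGaussian ρ) :=
    (lintegral_ofReal_ne_top_iff_integrable hm (ae_mul_signedPow_nonneg a b hρ)).1 h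
  rw [correlatedGaussian_of_abs_eq_one hρ] at hi hm
  rw [integrable_map_measure hm (by fun_prop)] at hi
  refine hi.congr ?_
  filter_upwards [ae_signedPow_mul_signedPow a b hρ] with x hx
  rw [Function.comp_apply, hx, ← mul_assoc, ← pow_two, ← sq_abs, hρ, one_pow, one_mul]

theorem continuousAt_signedPow (c : ℝ) {t : ℝ} (ht : t ≠ 0) : ContinuousAt (signedPow c) t := by
  have h : signedPow c = fun t => t / |t| * |t| ^ c := by
    ext t
    rw [signedPow]
    rcases eq_or_ne t 0 with rfl | ht
    · simp
    · rw [eq_div_of_mul_eq (abs_pos.2 ht).ne' (real_sign_mul_abs t)]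
  rw [h]
  have h1 : ContinuousAt (fun t : ℝ => |t|) t := continuous_abs.continuousAt
  exact (continuousAt_id.div h1 (abs_pos.2 ht).ne').mul
    (h1.rpow_const (Or.inl (abs_pos.2 ht).ne'))

theorem add_rpow_le_two_rpow_mul {x y a : ℝ} (hx : 0 ≤ x) (hy : 0 ≤ y) (ha : 0 ≤ a) :
    (x + y) ^ a ≤ 2 ^ a * (x ^ a + y ^ a) := by
  have h1 := Real.rpow_nonneg hx a
  have h2 := Real.rpow_nonneg hy a
  rcases le_total x y with h | h
  · calc (x + y) ^ a ≤ (2 * y) ^ a := Real.rpow_le_rpow (by positivity) (by linarith) ha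
      _ = 2 ^ a * y ^ a := Real.mul_rpow (by norm_num) hy
      _ ≤ _ := by gcongr; linarith
  · calc (x + y) ^ a ≤ (2 * x) ^ a := Real.rpow_le_rpow (by positivity) (by linarith) ha
      _ = 2 ^ a * x ^ a := Real.mul_rpow (by norm_num) hx
      _ ≤ _ := by gcongr; linarith

theorem integral_signedPow_correlatedGaussian_eq_prod (a b ρ : ℝ) :
    ∫ z, signedPow a z.1 * signedPow b z.2 ∂(correlatedGaussian ρ) =
      ∫ z, signedPow a (ρ * z.1 + √(1 - ρ ^ 2) * z.2) * signedPow b z.1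
        ∂((gaussianReal 0 1).prod (gaussianReal 0 1)) := by
  rw [correlatedGaussian, integral_map (by fun_prop)
    (Measurable.aestronglyMeasurable (by fun_prop))]

/-- Positivity of `a` gives a majorant independent of `ρ`, since `|g₁|^a` is then bounded by `2^a
(|x|^a + |y|^a)`. -/
theorem tendsto_integral_signedPow_correlatedGaussian {a b : ℝ} (ha : 0 < a) (hb : 0 < b) :
    Tendsto (fun ρ : ℝ => ∫ z, signedPow a z.1 * signedPow b z.2 ∂(correlatedGaussian ρ))
      (𝓝[<] 1) (𝓝 (∫ z, signedPow a z.1 * signedPow b z.2 ∂(correlatedGaussian 1))) := by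
  simp_rw [integral_signedPow_correlatedGaussian_eq_prod]
  have hae : ∀ᵐ z ∂((gaussianReal 0 1).prod (gaussianReal 0 1)), z.1 ≠ 0 :=
    Measure.quasiMeasurePreserving_fst.ae ae_ne_zero_gaussianReal
  have hMa := integrable_abs_rpow_gaussianReal (q := a) (by linarith)
  have hMb := integrable_abs_rpow_gaussianReal (q := b) (by linarith)
  have hMab := integrable_abs_rpow_gaussianReal (q := a + b) (by linarith)
  have h1 : Integrable (fun _ : ℝ => (1 : ℝ)) (gaussianReal 0 1) := integrable_const 1
  refine tendsto_integral_filter_of_dominated_convergence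
    (fun z : ℝ × ℝ => 2 ^ a * (|z.1| ^ (a + b) * 1 + |z.1| ^ b * |z.2| ^ a))
    (Eventually.of_forall fun ρ => Measurable.aestronglyMeasurable (by fun_prop)) ?_
    (((hMab.mul_prod h1).add (hMb.mul_prod hMa)).const_mul _) ?_
  · filter_upwards [Ioo_mem_nhdsLT (show (0 : ℝ) < 1 by norm_num)] with ρ hρ
    filter_upwards [hae] with z hz
    have hs : √(1 - ρ ^ 2) ≤ 1 := Real.sqrt_le_one.2 (by nlinarith [hρ.1, hρ.2])
    have hle : |ρ * z.1 + √(1 - ρ ^ 2) * z.2| ≤ |z.1| + |z.2| := by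
      refine (abs_add_le _ _).trans (add_le_add ?_ ?_)
      · rw [abs_mul, abs_of_pos hρ.1]
        exact mul_le_of_le_one_left (abs_nonneg _) hρ.2.le
      · rw [abs_mul, abs_of_nonneg (Real.sqrt_nonneg _)]
        exact mul_le_of_le_one_left (abs_nonneg _) hs
    rw [norm_mul]
    calc _ ≤ |ρ * z.1 + √(1 - ρ ^ 2) * z.2| ^ a * |z.1| ^ b :=
          mul_le_mul (abs_signedPow_le _ _) (abs_signedPow_le _ _) (abs_nonneg _)
            (Real.rpow_nonneg (abs_nonneg _) _)
      _ ≤ 2 ^ a * (|z.1| ^ a + |z.2| ^ a) * |z.1| ^ b := by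
          refine mul_le_mul_of_nonneg_right ?_ (Real.rpow_nonneg (abs_nonneg _) _)
          exact (Real.rpow_le_rpow (abs_nonneg _) hle ha.le).trans
            (add_rpow_le_two_rpow_mul (abs_nonneg _) (abs_nonneg _) ha.le)
      _ = _ := by rw [Real.rpow_add (abs_pos.2 hz)]; ring
  · filter_upwards [hae] with z hz
    refine Tendsto.mul_const _ ?_
    -- The limiting argument is `z.1`, almost surely nonzero, so the jump or pole of `signedPow` at
    -- the origin is avoided.
    have hne : 1 * z.1 + √(1 - 1 ^ 2) * z.2 ≠ 0 := by simpa using hz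
    have hc : ContinuousAt (fun ρ : ℝ => ρ * z.1 + √(1 - ρ ^ 2) * z.2) 1 := by fun_prop
    exact ((continuousAt_signedPow a hne).tendsto.comp hc.tendsto).mono_left nhdsWithin_le_nhds

theorem integral_abs_rpow_add_of_pos {a b : ℝ} (ha : 0 < a) (hb : 0 < b) :
    ∫ x, |x| ^ (a + b) ∂(gaussianReal 0 1) =
      (∫ x, |x| ^ (a + 1) ∂(gaussianReal 0 1)) * (∫ x, |x| ^ (b + 1) ∂(gaussianReal 0 1)) *
        ordinaryHypergeometric ((1 - a) / 2) ((1 - b) / 2) (3 / 2 : ℝ) (1 : ℝ) := by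
  have h1 := tendsto_integral_signedPow_correlatedGaussian ha hb
  rw [integral_signedPow_of_abs_eq_one a b abs_one, one_mul] at h1
  have hsq : Tendsto (fun ρ : ℝ => ρ ^ 2) (𝓝[<] 1) (𝓝[<] 1) := by
    refine tendsto_nhdsWithin_iff.2 ⟨?_, ?_⟩
    · have : ContinuousAt (fun ρ : ℝ => ρ ^ 2) 1 := by fun_prop
      simpa using this.tendsto.mono_left nhdsWithin_le_nhds
    · filter_upwards [Ioo_mem_nhdsLT (show (0 : ℝ) < 1 by norm_num)] with ρ hρ
      exact pow_lt_one₀ hρ.1.le hρ.2 two_ne_zero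
  have hid : Tendsto (fun ρ : ℝ => ρ) (𝓝[<] 1) (𝓝 1) := tendsto_id.mono_left nhdsWithin_le_nhds
  have h2 := ((hid.mul ((tendsto_ordinaryHypergeometric_one (α := (1 - a) / 2)
    (β := (1 - b) / 2) (γ := 3 / 2) (by norm_num) (by linarith)).comp hsq)).const_mul
      ((∫ x, |x| ^ (a + 1) ∂(gaussianReal 0 1)) * ∫ x, |x| ^ (b + 1) ∂(gaussianReal 0 1)))
  rw [one_mul] at h2
  refine tendsto_nhds_unique h1 (h2.congr' ?_)
  filter_upwards [Ioo_mem_nhdsLT (show (0 : ℝ) < 1 by norm_num)] with ρ hρ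
  rw [integral_signedPow_correlatedGaussian (by linarith) (by linarith)
    (abs_lt.2 ⟨by linarith [hρ.1], hρ.2⟩)]
  rfl

/-- The moment recursion contributes `a + b + 1` on the left and `a + 2` on the right, which are
twice the factors of the contiguous relation. -/
theorem integral_abs_rpow_add_of_add_two {a b : ℝ} (ha : -1 < a) (hab : -1 < a + b)
    (h : ∫ x, |x| ^ (a + 2 + b) ∂(gaussianReal 0 1) =
      (∫ x, |x| ^ (a + 2 + 1) ∂(gaussianReal 0 1)) * (∫ x, |x| ^ (b + 1) ∂(gaussianReal 0 1)) *
        ordinaryHypergeometric ((1 - (a + 2)) / 2) ((1 - b) / 2) (3 / 2 : ℝ) (1 : ℝ)) :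
    ∫ x, |x| ^ (a + b) ∂(gaussianReal 0 1) =
      (∫ x, |x| ^ (a + 1) ∂(gaussianReal 0 1)) * (∫ x, |x| ^ (b + 1) ∂(gaussianReal 0 1)) *
        ordinaryHypergeometric ((1 - a) / 2) ((1 - b) / 2) (3 / 2 : ℝ) (1 : ℝ) := by
  have hF := ordinaryHypergeometric_sub_one_at_one (α := (1 - a) / 2) (β := (1 - b) / 2)
    (γ := 3 / 2) (by norm_num) (by linarith)
  rw [show (1 - (a + 2)) / 2 = (1 - a) / 2 - 1 by ring, show a + 2 + b = a + b + 2 by ring,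
    show a + 2 + 1 = a + 1 + 2 by ring, integral_abs_rpow_add_two_gaussianReal hab,
    integral_abs_rpow_add_two_gaussianReal (by linarith)] at h
  have hne : a + b + 1 ≠ 0 := by linarith
  apply mul_left_cancel₀ hne
  linear_combination h + 2 * (∫ x, |x| ^ (a + 1) ∂(gaussianReal 0 1)) *
    (∫ x, |x| ^ (b + 1) ∂(gaussianReal 0 1)) * hF

/-- Gauss's evaluation of the hypergeometric function at `1`, in terms of Gaussian moments. -/
theorem integral_abs_rpow_add {a b : ℝ} (ha : -1 < a) (hb : -1 < b) (hab : -1 < a + b) :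
    ∫ x, |x| ^ (a + b) ∂(gaussianReal 0 1) =
      (∫ x, |x| ^ (a + 1) ∂(gaussianReal 0 1)) * (∫ x, |x| ^ (b + 1) ∂(gaussianReal 0 1)) *
        ordinaryHypergeometric ((1 - a) / 2) ((1 - b) / 2) (3 / 2 : ℝ) (1 : ℝ) := by
  have hsymm : ∀ α β : ℝ, ordinaryHypergeometric α β (3 / 2 : ℝ) (1 : ℝ) =
      ordinaryHypergeometric β α (3 / 2 : ℝ) (1 : ℝ) := fun α β => by
    rw [ordinaryHypergeometric, ordinaryHypergeometricSeries_symm, ordinaryHypergeometric]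
  -- Both `a + 2` and `b + 2` are positive; the descent is applied once in each variable, using
  -- symmetry of the upper parameters.
  refine integral_abs_rpow_add_of_add_two ha hab ?_
  have h := integral_abs_rpow_add_of_add_two (a := b) (b := a + 2) hb (by linarith) (by
    exact integral_abs_rpow_add_of_pos (by linarith) (by linarith))
  rw [add_comm (a + 2) b, h, hsymm]
  ring

end Endpoints

/-! ### The identity on `[-1, 1]`, Taylor coefficients, and the arcsine -/

section Conclusion

open scoped Topology

theorem normalizedCorrelation_of_abs_lt_one {a b ρ : ℝ} (ha : -1 < a) (hb : -1 < b)
    (hρ : |ρ| < 1) :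
    normalizedCorrelation a b ρ =
      ρ * ordinaryHypergeometric ((1 - a) / 2) ((1 - b) / 2) (3 / 2 : ℝ) (ρ ^ 2) := by
  have h1 := integral_abs_rpow_gaussianReal_pos (q := a + 1) (by linarith)
  have h2 := integral_abs_rpow_gaussianReal_pos (q := b + 1) (by linarith)
  rw [normalizedCorrelation_eq ha hb, integral_signedPow_correlatedGaussian ha hb hρ]
  exact mul_div_cancel_left₀ _ (mul_pos h1 h2).ne'

theorem normalizedCorrelation_of_abs_eq_one {a b ρ : ℝ} (ha : -1 < a) (hb : -1 < b)
    (hab : -1 < a + b) (hρ : |ρ| = 1) :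
    normalizedCorrelation a b ρ =
      ρ * ordinaryHypergeometric ((1 - a) / 2) ((1 - b) / 2) (3 / 2 : ℝ) (ρ ^ 2) := by
  have h1 := integral_abs_rpow_gaussianReal_pos (q := a + 1) (by linarith)
  have h2 := integral_abs_rpow_gaussianReal_pos (q := b + 1) (by linarith)
  rw [normalizedCorrelation_eq ha hb, integral_signedPow_of_abs_eq_one a b hρ,
    integral_abs_rpow_add ha hb hab, ← sq_abs ρ, hρ, one_pow, mul_left_comm]
  exact mul_div_cancel_left₀ _ (mul_pos h1 h2).ne'

theorem abs_sq_lt_one {ρ : ℝ} (hρ : |ρ| < 1) : |ρ ^ 2| < 1 := by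
  rw [abs_pow]; exact pow_lt_one₀ (abs_nonneg ρ) hρ two_ne_zero

/-- The Taylor series at `0` of `ρ ↦ ρ F(α, β; γ; ρ²)`. -/
theorem hasFPowerSeriesOnBall_mul_ordinaryHypergeometric_sq (α β : ℝ) {γ : ℝ} (hγ : 0 < γ) :
    HasFPowerSeriesOnBall (fun ρ : ℝ => ρ * ordinaryHypergeometric α β γ (ρ ^ 2))
      (FormalMultilinearSeries.ofScalars ℝ fun n =>
        if Odd n then ordinaryHypergeometricCoefficient α β γ (n / 2) else 0) 0 1 := by
  set c : ℕ → ℝ := fun n =>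
    if Odd n then ordinaryHypergeometricCoefficient α β γ (n / 2) else 0 with hc
  have hinj : Function.Injective fun k : ℕ => 2 * k + 1 := fun i j hij => by
    simp only at hij; lia
  have hodd : ∀ (r : ℝ) (k : ℕ), c (2 * k + 1) * r ^ (2 * k + 1) =
      r * (ordinaryHypergeometricCoefficient α β γ k * (r ^ 2) ^ k) := by
    intro r k
    rw [hc]
    simp only [odd_two_mul_add_one, if_true, show (2 * k + 1) / 2 = k by lia]
    rw [pow_succ, pow_mul]; ring
  have hzero : ∀ (r : ℝ), ∀ n ∉ Set.range (fun k : ℕ => 2 * k + 1), c n * r ^ n = 0 := by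
    intro r n hn
    have : ¬ Odd n := fun ⟨k, hk⟩ => hn ⟨k, hk.symm⟩
    simp [hc, this]
  have hsum : ∀ r : ℝ, |r| < 1 → HasSum (fun n => c n * r ^ n)
      (r * ordinaryHypergeometric α β γ (r ^ 2)) := by
    intro r hr
    rw [← hinj.hasSum_iff (hzero r), ordinaryHypergeometric_real_eq_tsum]
    simp only [Function.comp_def, hodd]
    exact (summable_norm_ordinaryHypergeometricCoefficient_mul_pow α β hγ
      (abs_sq_lt_one hr)).of_norm.hasSum.mul_left r
  refine ⟨?_, one_pos, fun {y} hy => ?_⟩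
  · refine ENNReal.le_of_forall_nnreal_lt fun r hr => ?_
    have hr1 : |(r : ℝ)| < 1 := by
      rw [NNReal.abs_eq]; exact_mod_cast hr
    refine FormalMultilinearSeries.le_radius_of_summable_norm _ ?_
    refine (hsum r hr1).summable.norm.congr fun n => ?_
    rw [norm_mul, norm_pow, Real.norm_of_nonneg r.coe_nonneg,
      FormalMultilinearSeries.ofScalars_norm]
  · have hy1 : |y| < 1 := by
      simpa [Metric.mem_eball, edist_dist, Real.dist_eq] using hy
    rw [zero_add]
    simpa [FormalMultilinearSeries.ofScalars_apply_eq, mul_comm] using hsum y hy1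

theorem hasFPowerSeriesAt_normalizedCorrelation {a b : ℝ} (ha : -1 < a) (hb : -1 < b) :
    HasFPowerSeriesAt (normalizedCorrelation a b)
      (FormalMultilinearSeries.ofScalars ℝ fun n => if Odd n then
        ordinaryHypergeometricCoefficient ((1 - a) / 2) ((1 - b) / 2) (3 / 2 : ℝ) (n / 2)
        else 0) 0 := by
  refine (hasFPowerSeriesOnBall_mul_ordinaryHypergeometric_sq _ _
    (by norm_num)).hasFPowerSeriesAt.congr ?_
  have : ∀ᶠ ρ : ℝ in 𝓝 0, |ρ| < 1 := continuous_abs.continuousAt.eventually_lt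
    continuousAt_const (by simp)
  filter_upwards [this] with ρ hρ
  exact (normalizedCorrelation_of_abs_lt_one ha hb hρ).symm

theorem iteratedDeriv_normalizedCorrelation {a b : ℝ} (ha : -1 < a) (hb : -1 < b) (k : ℕ) :
    iteratedDeriv (2 * k + 1) (normalizedCorrelation a b) 0 / ((2 * k + 1).factorial : ℝ) =
      ordinaryHypergeometricCoefficient ((1 - a) / 2) ((1 - b) / 2) (3 / 2 : ℝ) k := by
  have h := hasFPowerSeriesAt_normalizedCorrelation ha hb
  -- Power series expansions are unique, so the Taylor series is the one just found.
  have heq := h.analyticAt.hasFPowerSeriesAt.eq_formalMultilinearSeries h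
  have := congrArg (fun p : FormalMultilinearSeries ℝ ℝ ℝ => p.coeff (2 * k + 1)) heq
  simp only [FormalMultilinearSeries.coeff_ofScalars, odd_two_mul_add_one, if_true,
    show (2 * k + 1) / 2 = k by lia] at this
  exact this

theorem ascPochhammer_one_half_mul (k : ℕ) :
    (ascPochhammer ℝ k).eval (3 / 2) = (ascPochhammer ℝ k).eval (1 / 2) * (2 * k + 1) := by
  induction k with
  | zero => simp
  | succ k ih =>
    rw [ascPochhammer_succ_eval, ascPochhammer_succ_eval, ih]
    push_cast
    ring

/-- Differentiating `x ^ (2 * k + 1)` produces the factor `2 * k + 1`, leaving the binomial series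
of `(1 - x²) ^ (-1/2)`. -/
theorem ordinaryHypergeometricCoefficient_arcsin (k : ℕ) :
    ordinaryHypergeometricCoefficient (1 / 2) (1 / 2) (3 / 2 : ℝ) k * (2 * k + 1) =
      ordinaryHypergeometricCoefficient (1 / 2) 1 (1 : ℝ) k := by
  have h1 := (ascPochhammer_pos k (1 / 2 : ℝ) (by norm_num)).ne'
  have h2 := (ascPochhammer_pos k (1 : ℝ) one_pos).ne'
  have h3 : (2 * (k : ℝ) + 1) ≠ 0 := by positivity
  simp only [ordinaryHypergeometricCoefficient, ascPochhammer_one_half_mul]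
  field_simp

theorem hasDerivAt_mul_ordinaryHypergeometric_arcsin {x : ℝ} (hx : |x| < 1) :
    HasDerivAt (fun x : ℝ => x * ordinaryHypergeometric (1 / 2) (1 / 2) (3 / 2 : ℝ) (x ^ 2))
      (1 / √(1 - x ^ 2)) x := by
  obtain ⟨r, hr, hr1⟩ := exists_between hx
  have hr0 : 0 < r := (abs_nonneg x).trans_lt hr
  have habs : |r| < 1 := by rwa [abs_of_pos hr0]
  have h := hasDerivAt_tsum_of_isPreconnected
    (g := fun (k : ℕ) (y : ℝ) =>
      ordinaryHypergeometricCoefficient (1 / 2) (1 / 2) (3 / 2 : ℝ) k * y ^ (2 * k + 1))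
    (g' := fun (k : ℕ) (y : ℝ) =>
      ordinaryHypergeometricCoefficient (1 / 2) 1 (1 : ℝ) k * (y ^ 2) ^ k)
    (t := Metric.ball 0 r) (y₀ := 0) (y := x)
    (summable_norm_ordinaryHypergeometricCoefficient_mul_pow (1 / 2) 1 one_pos
      (abs_sq_lt_one habs))
    Metric.isOpen_ball (convex_ball 0 r).isPreconnected
    (fun k y _ => by
      have := (hasDerivAt_pow (2 * k + 1) y).const_mul
        (ordinaryHypergeometricCoefficient (1 / 2) (1 / 2) (3 / 2 : ℝ) k)
      convert! this using 1
      rw [← ordinaryHypergeometricCoefficient_arcsin, ← pow_mul]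
      push_cast
      ring)
    (fun k y hy => by
      have hy : |y| < r := by simpa using hy
      rw [norm_mul (ordinaryHypergeometricCoefficient _ _ _ k),
        norm_mul (ordinaryHypergeometricCoefficient _ _ _ k)]
      refine mul_le_mul_of_nonneg_left ?_ (norm_nonneg _)
      rw [norm_pow, norm_pow, norm_pow, norm_pow, Real.norm_eq_abs y, Real.norm_eq_abs r,
        abs_of_pos hr0]
      gcongr)
    (by simpa using hr0) (by simp) (by simpa using hr)
  have hx2 : 0 < 1 - x ^ 2 := by
    have := (sq_lt_one_iff_abs_lt_one x).2 hx
    linarith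
  rw [← ordinaryHypergeometric_real_eq_tsum] at h
  have h1 : ordinaryHypergeometric (1 / 2 : ℝ) 1 1 (x ^ 2) = 1 / √(1 - x ^ 2) := by
    have := ordinaryHypergeometric_one_one (-(1 / 2)) (abs_sq_lt_one hx)
    rw [neg_neg] at this
    rw [this, Real.rpow_neg hx2.le, ← Real.sqrt_eq_rpow, one_div]
  rw [h1] at h
  convert! h using 2 with y
  rw [ordinaryHypergeometric_real_eq_tsum, ← tsum_mul_left]
  refine tsum_congr fun k => ?_
  ring

theorem arcsin_eq_mul_ordinaryHypergeometric {x : ℝ} (hx : |x| < 1) :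
    x * ordinaryHypergeometric (1 / 2) (1 / 2) (3 / 2 : ℝ) (x ^ 2) = Real.arcsin x := by
  have hd : ∀ y ∈ Set.Ioo (-1 : ℝ) 1, HasDerivAt (fun x : ℝ =>
      x * ordinaryHypergeometric (1 / 2) (1 / 2) (3 / 2 : ℝ) (x ^ 2) - Real.arcsin x) 0 y := by
    intro y hy
    have := (hasDerivAt_mul_ordinaryHypergeometric_arcsin (abs_lt.2 hy)).sub
      (Real.hasDerivAt_arcsin hy.1.ne' hy.2.ne)
    rwa [sub_self] at this
  have h := isOpen_Ioo.is_const_of_deriv_eq_zero isPreconnected_Ioo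
    (fun y hy => (hd y hy).differentiableAt.differentiableWithinAt)
    (fun y hy => (hd y hy).deriv) (abs_lt.1 hx) (show (0 : ℝ) ∈ Set.Ioo (-1 : ℝ) 1 by simp)
  simpa [sub_eq_zero] using h

/-- **Grothendieck's identity**. -/
theorem integral_sign_mul_sign_correlatedGaussian {ρ : ℝ} (hρ : ρ ∈ Set.Icc (-1 : ℝ) 1) :
    ∫ z, Real.sign z.1 * Real.sign z.2 ∂(correlatedGaussian ρ) =
      2 / Real.pi * Real.arcsin ρ := by
  have h0 : ∀ t, Real.sign t = signedPow 0 t := fun t => by simp [signedPow]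
  simp_rw [h0]
  rcases (abs_le.2 hρ).lt_or_eq with h | h
  · rw [integral_signedPow_correlatedGaussian (by norm_num) (by norm_num) h, sub_zero,
      arcsin_eq_mul_ordinaryHypergeometric h, integral_abs_rpow_gaussianReal (by norm_num)]
    -- The prefactor is `(E|g|)² = 2 / π`.
    congr 1
    have hpi := Real.mul_self_sqrt (show 0 ≤ 2 * Real.pi by positivity)
    have h1 : ((0 : ℝ) + 1 + 1) / 2 = 1 := by norm_num
    have h2 : -((0 : ℝ) + 1 + 1) / 2 = -1 := by norm_num
    rw [h1, h2, Real.Gamma_one, Real.rpow_neg_one, mul_mul_mul_comm, ← mul_inv, hpi]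
    field_simp
  · rw [integral_signedPow_of_abs_eq_one 0 0 h]
    rcases eq_or_eq_neg_of_abs_eq h with rfl | rfl
    · simp [Real.arcsin_one]
    · simp [Real.arcsin_neg, Real.arcsin_one]

end Conclusion

theorem mainTheorem2 (a b : ℝ) (ha : -1 < a) (hb : -1 < b) :
    -- the hypergeometric representation, with convergence of both sides
    (∀ ρ ∈ Set.Icc (-1 : ℝ) 1, (|ρ| < 1 ∨ -1 < a + b) →
      Integrable (fun z : ℝ × ℝ => signedPow a z.1 * signedPow b z.2) (correlatedGaussian ρ) ∧
      Summable (fun k : ℕ =>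
        ordinaryHypergeometricCoefficient ((1 - a) / 2) ((1 - b) / 2) (3 / 2 : ℝ) k *
          (ρ ^ 2) ^ k) ∧
      normalizedCorrelation a b ρ =
        ρ * ordinaryHypergeometric ((1 - a) / 2) ((1 - b) / 2) (3 / 2 : ℝ) (ρ ^ 2)) ∧
    -- in the remaining case both sides are infinite, with the sign of `ρ`
    (∀ ρ : ℝ, |ρ| = 1 → a + b ≤ -1 →
      (∀ᵐ z ∂(correlatedGaussian ρ), 0 ≤ ρ * (signedPow a z.1 * signedPow b z.2)) ∧
      ∫⁻ z, ENNReal.ofReal (ρ * (signedPow a z.1 * signedPow b z.2)) ∂(correlatedGaussian ρ) = ⊤ ∧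
      Tendsto (fun n : ℕ => ∑ k ∈ Finset.range n,
        ordinaryHypergeometricCoefficient ((1 - a) / 2) ((1 - b) / 2) (3 / 2 : ℝ) k *
          (ρ ^ 2) ^ k) atTop atTop) ∧
    -- the Taylor coefficients at `0`
    (AnalyticAt ℝ (normalizedCorrelation a b) 0 ∧
      ∀ k : ℕ, iteratedDeriv (2 * k + 1) (normalizedCorrelation a b) 0 /
          ((2 * k + 1).factorial : ℝ) =
        (ascPochhammer ℝ k).eval ((1 - a) / 2) * (ascPochhammer ℝ k).eval ((1 - b) / 2) /
          ((ascPochhammer ℝ k).eval (3 / 2) * (k.factorial : ℝ))) ∧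
    -- the special case of Grothendieck's identity
    (∀ ρ ∈ Set.Icc (-1 : ℝ) 1,
      ∫ z, Real.sign z.1 * Real.sign z.2 ∂(correlatedGaussian ρ) =
        2 / Real.pi * Real.arcsin ρ) := by
  have hc : (0 : ℝ) < 3 / 2 := by norm_num
  refine ⟨fun ρ hρ h => ?_, fun ρ hρ hab => ?_, ?_, fun ρ hρ =>
    integral_sign_mul_sign_correlatedGaussian hρ⟩
  · rcases (abs_le.2 hρ).lt_or_eq with h1 | h1
    · exact ⟨integrable_correlatedGaussian h1 (integrable_density_mul_signedPow ha hb h1),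
        (summable_norm_ordinaryHypergeometricCoefficient_mul_pow _ _ hc
          (abs_sq_lt_one h1)).of_norm, normalizedCorrelation_of_abs_lt_one ha hb h1⟩
    · have hab : -1 < a + b := h.resolve_left h1.not_lt
      refine ⟨integrable_signedPow_of_abs_eq_one hab h1, ?_,
        normalizedCorrelation_of_abs_eq_one ha hb hab h1⟩
      rw [← sq_abs ρ, h1]
      simpa only [one_pow, mul_one] using
        summable_ordinaryHypergeometricCoefficient hc
          (show 0 < 3 / 2 - (1 - a) / 2 - (1 - b) / 2 by linarith)
  · refine ⟨ae_mul_signedPow_nonneg a b hρ, lintegral_mul_signedPow_eq_top hab hρ, ?_⟩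
    rw [← sq_abs ρ, hρ]
    -- With `a, b > -1`, the bound `a + b ≤ -1` forces `a, b < 0`, so both upper parameters are
    -- positive.
    simpa only [one_pow, mul_one] using
      tendsto_sum_ordinaryHypergeometricCoefficient_atTop
        (show 0 < (1 - a) / 2 by linarith) (show 0 < (1 - b) / 2 by linarith) hc (by linarith)
  · refine ⟨(hasFPowerSeriesAt_normalizedCorrelation ha hb).analyticAt, fun k => ?_⟩
    rw [iteratedDeriv_normalizedCorrelation ha hb, ordinaryHypergeometricCoefficient]
    field_simp
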